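/- Let $\mathbf H,\mathbf E$ be non-zero real $L\times K$ matrices with $d=\operatorname{rank}\mathbf H<\min(L,K)$, and let $\|\cdot\|$ be the spectral norm. Put $\mathbf A=\mathbf H\mathbf H^{\rm T}$, $\mathbf A^{(1)}=\mathbf H\mathbf E^{\rm T}+\mathbf E\mathbf H^{\rm T}$, $\mathbf A^{(2)}=\mathbf E\mathbf E^{\rm T}$, and for $\delta\in\mathbb R$ $$\mathbf B(\delta)=\delta\mathbf A^{(1)}+\delta^2\mathbf A^{(2)},\qquad B(\delta)=|\delta|\,\|\mathbf A^{(1)}\|+\delta^2\|\mathbf A^{(2)}\|.$$ Let $\mathbf P_\mu$ be the orthogonal projector of $\mathbb R^L$ onto the eigenspace of $\mathbf A$ for the eigenvalue $\mu$ (so $\mathbf P_0$ projects onto the kernel of $\mathbf A$), $\mathbf P_0^\perp=\mathbf I-\mathbf P_0$, let $\mu_{\min}$ be the minimal positive eigenvalue of $\mathbf A$, and let $\mathbf S_0=\sum_{\mu>0}\mathbf P_\mu/\mu$ be the pseudoinverse of $\mathbf A$; here and below sums over $\mu>0$ or $\mu_k>0$ run over the distinct positive eigenvalues of $\mathbf A$.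 Let $\mathbf P_0^\perp(\delta)$ be the orthogonal projector onto the span of the $d$ leading left singular vectors of $\mathbf H(\delta)=\mathbf H+\delta\mathbf E$ (equivalently, the $d$ leading eigenvectors of $\mathbf H(\delta)\mathbf H(\delta)^{\rm T}$). Put $\mathbf A^{(2)}_0=\mathbf P_0\mathbf A^{(2)}\mathbf P_0$. Assume that $\delta_0>0$, $B(\delta_0)=\mu_{\min}/4$ and $|\delta|<\delta_0$. Then $\mathbf I-\delta^2\mathbf A^{(2)}_0/\mu$ is invertible for every positive eigenvalue $\mu$ of $\mathbf A$. Let $$\mathbf L_1(\delta)=\sum_{\mu>0}\frac{\mathbf P_\mu\mathbf B(\delta)\mathbf P_0}{\mu}\left(\mathbf I-\delta^2\mathbf A^{(2)}_0/\mu\right)^{-1},$$ $$\mathbf J_i=\mathbf J_i(\mu_1,\ldots,\mu_i)=\prod_{k=1}^i\frac{\mathbf P_{\mu_k}\mathbf B(\delta)}{\mu_k},\qquad \mathbf G_i=\mathbf G_i(\mu_1,\ldots,\mu_i)=\prod_{k=1}^i\left(\mathbf I-\delta^2\mathbf A^{(2)}_0/\mu_k\right)^{-1}$$ (products in the order $k=1,\dots,i$,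 empty products equal to $\mathbf I$). The series $$\mathbf T_1(\delta)=\sum_{i=0}^\infty(-1)^i\sum_{\mu_1,\ldots,\mu_i>0}\mathbf J_i\,\mathbf L_1(\delta)\,\mathbf G_i$$ (whose $i$-th term is the whole finite inner sum) converges absolutely, and with $\mathbf T(\delta)=\mathbf T_1(\delta)+\mathbf T_1(\delta)^{\rm T}$ and $C=e^{1/6}/\sqrt\pi$, $$\big\|\mathbf P_0^\perp(\delta)-\mathbf P_0^\perp-\mathbf T(\delta)\big\|\le 16\,C\,\frac{\|\mathbf S_0\mathbf B(\delta)\mathbf P_0\|^2}{1-4\|\mathbf B(\delta)\|/\mu_{\min}}.$$ -/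

import Mathlib

open scoped Matrix Matrix.Norms.L2Operator

noncomputable section

namespace SignalSubspace

/-- The matrix of the orthogonal projector of `ℝᴸ` onto a linear subspace `U`. -/
def projMatrix {L : ℕ} (U : Submodule ℝ (EuclideanSpace ℝ (Fin L))) :
    Matrix (Fin L) (Fin L) ℝ :=
  (Matrix.toEuclideanCLM (n := Fin L) (𝕜 := ℝ)).symm U.starProjection

/-- `A = H Hᵀ`. -/
def gram {L K : ℕ} (H : Matrix (Fin L) (Fin K) ℝ) : Matrix (Fin L) (Fin L) ℝ :=
  H * Hᵀ

/-- `A⁽¹⁾ = H Eᵀ + E Hᵀ`. -/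
def A₁ {L K : ℕ} (H E : Matrix (Fin L) (Fin K) ℝ) : Matrix (Fin L) (Fin L) ℝ :=
  H * Eᵀ + E * Hᵀ

/-- `A⁽²⁾ = E Eᵀ`. -/
def A₂ {L K : ℕ} (E : Matrix (Fin L) (Fin K) ℝ) : Matrix (Fin L) (Fin L) ℝ :=
  E * Eᵀ

/-- The perturbation `B(δ) = δ A⁽¹⁾ + δ² A⁽²⁾` of `H Hᵀ`. -/
def pert {L K : ℕ} (H E : Matrix (Fin L) (Fin K) ℝ) (δ : ℝ) : Matrix (Fin L) (Fin L) ℝ :=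
  δ • A₁ H E + δ ^ 2 • A₂ E

/-- The scalar function `|δ| ‖A⁽¹⁾‖ + δ² ‖A⁽²⁾‖` (spectral norms). -/
def pertBound {L K : ℕ} (H E : Matrix (Fin L) (Fin K) ℝ) (δ : ℝ) : ℝ :=
  |δ| * ‖A₁ H E‖ + δ ^ 2 * ‖A₂ E‖

/-- The finite set of positive eigenvalues of `H Hᵀ`. -/
def posEig {L K : ℕ} (H : Matrix (Fin L) (Fin K) ℝ) : Finset ℝ :=
  (Matrix.finite_spectrum (gram H)).toFinset.filter (fun μ => 0 < μ)

/-- The minimal positive eigenvalue of `H Hᵀ`. -/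
def muMin {L K : ℕ} (H : Matrix (Fin L) (Fin K) ℝ) : ℝ :=
  sInf (posEig H : Set ℝ)

/-- `P_μ`, the orthogonal projector onto the eigenspace of `H Hᵀ` for `μ`
(`P₀` is the case `μ = 0`). -/
def eigProj {L K : ℕ} (H : Matrix (Fin L) (Fin K) ℝ) (μ : ℝ) : Matrix (Fin L) (Fin L) ℝ :=
  projMatrix (Module.End.eigenspace (Matrix.toEuclideanLin (gram H)) μ)

/-- `P₀^⊥ = I - P₀`, the orthogonal projector onto the unperturbed signal subspace. -/
def signalProj {L K : ℕ} (H : Matrix (Fin L) (Fin K) ℝ) : Matrix (Fin L) (Fin L) ℝ :=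
  1 - eigProj H 0

/-- `S₀ = ∑_{μ > 0} P_μ / μ`, the pseudoinverse of `H Hᵀ`. -/
def pinv {L K : ℕ} (H : Matrix (Fin L) (Fin K) ℝ) : Matrix (Fin L) (Fin L) ℝ :=
  ∑ μ ∈ posEig H, μ⁻¹ • eigProj H μ

theorem gram_isSymmetric {L K : ℕ} (M : Matrix (Fin L) (Fin K) ℝ) :
    (Matrix.toEuclideanLin (gram M)).IsSymmetric := by
  rw [Matrix.isSymmetric_toEuclideanLin_iff]
  simpa [gram, Matrix.conjTranspose_eq_transpose_of_trivial] using
    Matrix.isHermitian_mul_conjTranspose_self M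

/-- The span of `d` leading left singular vectors of `M`, i.e. of the first `d` vectors of an
orthonormal basis of eigenvectors of `M Mᵀ` ordered by decreasing eigenvalues (eigenvalues
are repeated according to their multiplicities). When the `d`-th and the `(d+1)`-st eigenvalue differ,
the span does not depend on the basis. -/
def leadingSubspace {L K : ℕ} (M : Matrix (Fin L) (Fin K) ℝ) (d : ℕ) :
    Submodule ℝ (EuclideanSpace ℝ (Fin L)) :=
  Submodule.span ℝ
    ((gram_isSymmetric M).eigenvectorBasis finrank_euclideanSpace_fin '' {j : Fin L | (j : ℕ) < d})

/-- `P₀^⊥(δ)`, the orthogonal projector onto the span of the `d = rank H` leading left singular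
vectors of `H(δ) = H + δ E`. -/
def signalProjPert {L K : ℕ} (H E : Matrix (Fin L) (Fin K) ℝ) (δ : ℝ) :
    Matrix (Fin L) (Fin L) ℝ :=
  projMatrix (leadingSubspace (H + δ • E) H.rank)

/-- `A₀⁽²⁾ = P₀ A⁽²⁾ P₀`. -/
def A₂₀ {L K : ℕ} (H E : Matrix (Fin L) (Fin K) ℝ) : Matrix (Fin L) (Fin L) ℝ :=
  eigProj H 0 * A₂ E * eigProj H 0

/-- `I - δ² A₀⁽²⁾ / μ`. -/
def resArg {L K : ℕ} (H E : Matrix (Fin L) (Fin K) ℝ) (δ μ : ℝ) : Matrix (Fin L) (Fin L) ℝ :=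
  1 - (δ ^ 2 / μ) • A₂₀ H E

/-- `L₁(δ) = ∑_{μ > 0} (P_μ B(δ) P₀ / μ) (I - δ² A₀⁽²⁾ / μ)⁻¹`. -/
def L₁ {L K : ℕ} (H E : Matrix (Fin L) (Fin K) ℝ) (δ : ℝ) : Matrix (Fin L) (Fin L) ℝ :=
  ∑ μ ∈ posEig H, (μ⁻¹ • (eigProj H μ * pert H E δ * eigProj H 0)) * (resArg H E δ μ)⁻¹

/-- `Jᵢ(μ₁, …, μᵢ) = ∏_{k=1}^{i} (P_{μₖ} B(δ) / μₖ)`, the factors in this order. -/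
def J {L K : ℕ} (H E : Matrix (Fin L) (Fin K) ℝ) (δ : ℝ) {i : ℕ} (m : Fin i → ℝ) :
    Matrix (Fin L) (Fin L) ℝ :=
  (List.ofFn fun k => (m k)⁻¹ • (eigProj H (m k) * pert H E δ)).prod

/-- `Gᵢ(μ₁, …, μᵢ) = ∏_{k=1}^{i} (I - δ² A₀⁽²⁾ / μₖ)⁻¹`. -/
def G {L K : ℕ} (H E : Matrix (Fin L) (Fin K) ℝ) (δ : ℝ) {i : ℕ} (m : Fin i → ℝ) :
    Matrix (Fin L) (Fin L) ℝ :=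
  (List.ofFn fun k => (resArg H E δ (m k))⁻¹).prod

/-- The `i`-th term `(-1)ⁱ ∑_{μ₁, …, μᵢ > 0} Jᵢ L₁(δ) Gᵢ` of the series `T₁(δ)`. -/
def T₁term {L K : ℕ} (H E : Matrix (Fin L) (Fin K) ℝ) (δ : ℝ) (i : ℕ) :
    Matrix (Fin L) (Fin L) ℝ :=
  (-1 : ℝ) ^ i • ∑ m ∈ Fintype.piFinset (fun _ : Fin i => posEig H),
    J H E δ m * L₁ H E δ * G H E δ m

/-- `T₁(δ)`. -/
def T₁ {L K : ℕ} (H E : Matrix (Fin L) (Fin K) ℝ) (δ : ℝ) : Matrix (Fin L) (Fin L) ℝ :=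
  ∑' i : ℕ, T₁term H E δ i

/-- `T(δ) = T₁(δ) + T₁(δ)ᵀ`. -/
def T {L K : ℕ} (H E : Matrix (Fin L) (Fin K) ℝ) (δ : ℝ) : Matrix (Fin L) (Fin L) ℝ :=
  T₁ H E δ + (T₁ H E δ)ᵀ

end SignalSubspace

end

open SignalSubspace

/-! Write `A` for `H Hᵀ`, `B` for the perturbation, `P` for `P₀`, `S` for the pseudoinverse, `Q` for
the perturbed projector, `m` for `μ_min`. The hypotheses give `4‖B‖ < m`.

The series is the Neumann series of a Sylvester equation. The map `R` (`sylvesterInv`) satisfies `R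
Y = S (Y + R Y · PBP)`, where `PBP = δ² A₀⁽²⁾`. The terms of `T₁` start at `R (BP)` and obey `t ↦ -R
(B t)`, a map that contracts by `1/3`. Hence `T₁` solves `T = S (BP - BT + T·PBP)` (`T₁_eq`).

Since `Q` commutes with `A + B`, its off-diagonal block `V = (1-P)QP` solves the same equation up to
terms containing the diagonal defects `a = (1-P)(1-Q)(1-P)` and `b = PQP`. Idempotency of `Q` makes
`a` and `b` of order `‖V‖²`, so `V - T₁` is too, and so is `Q - (1-P) - (T₁ + T₁ᵀ) = -a + b + (V -
T₁) + (V - T₁)ᵀ`. The equation for `V` also gives `‖V‖ = O(‖SBP‖)`. This is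
`CStarRing.norm_projection_sub_le`, with constant `8 ≤ 16 C`.

The smallness of `a`, `b`, `V` needed to start comes from Weyl's inequality: the `d` leading
eigenvalues of `A + B` are at least `m - ‖B‖`, the others at most `‖B‖`. -/

/-! ### Simultaneously diagonal operators and Weyl's inequality -/

open scoped RealInnerProductSpace in
theorem norm_apply_le_of_diagonal {ι F : Type*} [Fintype ι] [NormedAddCommGroup F]
    [InnerProductSpace ℝ F] (b : OrthonormalBasis ι ℝ F) (W Z : F →ₗ[ℝ] F) (w z : ι → ℝ) (C : ℝ)
    (hC : 0 ≤ C) (hW : ∀ j, W (b j) = w j • b j) (hZ : ∀ j, Z (b j) = z j • b j)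
    (h : ∀ j, |w j| ≤ C * |z j|) (y : F) : ‖W y‖ ≤ C * ‖Z y‖ := by
  classical
  have key : ∀ (X : F →ₗ[ℝ] F) (x : ι → ℝ), (∀ j, X (b j) = x j • b j) →
      ‖X y‖ ^ 2 = ∑ j, (x j * ⟪b j, y⟫) ^ 2 := by
    intro X x hX
    rw [← b.sum_sq_norm_inner_right (X y)]
    refine Finset.sum_congr rfl fun j _ => ?_
    have hj : ⟪b j, X y⟫ = x j * ⟪b j, y⟫ := by
      conv_lhs => rw [← b.sum_repr' y]
      simp [map_sum, hX, inner_sum, real_inner_smul_right, b.inner_eq_ite, mul_comm]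
    rw [hj, Real.norm_eq_abs, sq_abs]
  refine (sq_le_sq₀ (norm_nonneg _) (mul_nonneg hC (norm_nonneg _))).mp ?_
  rw [mul_pow, key W w hW, key Z z hZ, Finset.mul_sum]
  refine Finset.sum_le_sum fun j _ => ?_
  rw [mul_pow, mul_pow, ← mul_assoc]
  refine mul_le_mul_of_nonneg_right ?_ (sq_nonneg _)
  rw [← sq_abs (w j), ← sq_abs (z j), ← mul_pow]
  exact pow_le_pow_left₀ (abs_nonneg _) (h j) 2

-- Courant–Fischer argument: a nonzero vector lying both in the span of the leading eigenvectors of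
-- `S` up to `i` and in the span of those of `T` from `i` on compares the two eigenvalues.
open scoped RealInnerProductSpace in
theorem LinearMap.IsSymmetric.eigenvalues_le_add {F : Type*} [NormedAddCommGroup F]
    [InnerProductSpace ℝ F] [FiniteDimensional ℝ F] {n : ℕ} (hn : Module.finrank ℝ F = n)
    {S T : F →ₗ[ℝ] F} (hS : S.IsSymmetric) (hT : T.IsSymmetric) (c : ℝ)
    (h : ∀ y, ⟪S y, y⟫ ≤ ⟪T y, y⟫ + c * ‖y‖ ^ 2) (i : Fin n) :
    hS.eigenvalues hn i ≤ hT.eigenvalues hn i + c := by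
  classical
  have quad : ∀ {R : F →ₗ[ℝ] F} (hR : R.IsSymmetric) (y : F),
      ⟪R y, y⟫ = ∑ j, hR.eigenvalues hn j * ⟪hR.eigenvectorBasis hn j, y⟫ ^ 2 := by
    intro R hR y
    rw [← (hR.eigenvectorBasis hn).sum_inner_mul_inner]
    refine Finset.sum_congr rfl fun j _ => ?_
    rw [hR y, hR.apply_eigenvectorBasis, real_inner_comm]
    simp only [RCLike.ofReal_real_eq_id, id_eq, real_inner_smul_left]
    ring
  have nrm : ∀ {R : F →ₗ[ℝ] F} (hR : R.IsSymmetric) (y : F),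
      ‖y‖ ^ 2 = ∑ j, ⟪hR.eigenvectorBasis hn j, y⟫ ^ 2 := by
    intro R hR y
    rw [← (hR.eigenvectorBasis hn).sum_sq_norm_inner_right y]
    simp
  have vanish : ∀ (b : OrthonormalBasis (Fin n) ℝ F) (s : Set (Fin n)) (y : F),
      y ∈ Submodule.span ℝ (b '' s) → ∀ j, j ∉ s → ⟪b j, y⟫ = 0 := by
    intro b s y hy j hj
    induction hy using Submodule.span_induction with
    | mem x hx =>
      obtain ⟨k, hk, rfl⟩ := hx
      rw [b.inner_eq_ite, if_neg]
      rintro rfl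
      exact hj hk
    | zero => simp
    | add x y _ _ hx hy => rw [inner_add_right, hx, hy, add_zero]
    | smul a x _ hx => rw [real_inner_smul_right, hx, mul_zero]
  have dim : ∀ (b : OrthonormalBasis (Fin n) ℝ F) (s : Finset (Fin n)),
      Module.finrank ℝ (Submodule.span ℝ (b '' (s : Set (Fin n)))) = s.card := by
    intro b s
    rw [← Finset.coe_image, finrank_span_finset_eq_card,
      Finset.card_image_of_injective _ b.orthonormal.linearIndependent.injective]
    rw [Finset.coe_image]
    exact b.orthonormal.linearIndependent.linearIndepOn_id.mono (Set.image_subset_range _ _)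
  set U := Submodule.span ℝ (hS.eigenvectorBasis hn '' (Finset.Iic i : Finset (Fin n)))
  set W := Submodule.span ℝ (hT.eigenvectorBasis hn '' (Finset.Ici i : Finset (Fin n)))
  have hUW : ¬ Disjoint U W := by
    intro hd
    have := Submodule.finrank_add_finrank_le_of_disjoint hd
    -- The dimensions are `i + 1` and `n - i`, with sum `n + 1`.
    rw [dim, dim, hn, Fin.card_Iic, Fin.card_Ici] at this
    omega
  rw [Submodule.disjoint_def] at hUW
  push Not at hUW
  obtain ⟨y, hyU, hyW, hy0⟩ := hUW
  have h1 : hS.eigenvalues hn i * ‖y‖ ^ 2 ≤ ⟪S y, y⟫ := by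
    rw [quad hS, nrm hS, Finset.mul_sum]
    refine Finset.sum_le_sum fun j _ => ?_
    by_cases hj : j ≤ i
    · exact mul_le_mul_of_nonneg_right (hS.eigenvalues_antitone hn hj) (sq_nonneg _)
    · rw [vanish _ _ y hyU j (by simpa using hj)]; simp
  have h2 : ⟪T y, y⟫ ≤ hT.eigenvalues hn i * ‖y‖ ^ 2 := by
    rw [quad hT, nrm hT, Finset.mul_sum]
    refine Finset.sum_le_sum fun j _ => ?_
    by_cases hj : i ≤ j
    · exact mul_le_mul_of_nonneg_right (hT.eigenvalues_antitone hn hj) (sq_nonneg _)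
    · rw [vanish _ _ y hyW j (by simpa using hj)]; simp
  have hpos : 0 < ‖y‖ ^ 2 := by positivity
  have h3 := h y
  nlinarith

/-! ### Matrices as operators on Euclidean space -/

open Matrix in
theorem Matrix.ext_orthonormalBasis {n : ℕ} {ι : Type*} [Fintype ι]
    (b : OrthonormalBasis ι ℝ (EuclideanSpace ℝ (Fin n))) {X Y : Matrix (Fin n) (Fin n) ℝ}
    (h : ∀ j, toEuclideanLin X (b j) = toEuclideanLin Y (b j)) : X = Y :=
  toEuclideanLin.injective (b.toBasis.ext fun j => by simpa using h j)

theorem Matrix.toEuclideanLin_mul_apply {n : ℕ} (X Y : Matrix (Fin n) (Fin n) ℝ)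
    (y : EuclideanSpace ℝ (Fin n)) :
    toEuclideanLin (X * Y) y = toEuclideanLin X (toEuclideanLin Y y) := by
  rw [← Matrix.coe_toEuclideanCLM_eq_toEuclideanLin, map_mul]
  rfl

theorem Matrix.toEuclideanLin_one_apply {n : ℕ} (y : EuclideanSpace ℝ (Fin n)) :
    toEuclideanLin (1 : Matrix (Fin n) (Fin n) ℝ) y = y := by
  rw [← Matrix.coe_toEuclideanCLM_eq_toEuclideanLin, map_one]
  rfl

theorem Matrix.l2_opNorm_mul_le_of_apply {n : ℕ} {X Z : Matrix (Fin n) (Fin n) ℝ} {C : ℝ}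
    (hC : 0 ≤ C) (h : ∀ y, ‖toEuclideanLin X y‖ ≤ C * ‖toEuclideanLin Z y‖)
    (Y : Matrix (Fin n) (Fin n) ℝ) : ‖X * Y‖ ≤ C * ‖Z * Y‖ := by
  rw [← Matrix.l2_opNorm_toEuclideanCLM]
  refine ContinuousLinearMap.opNorm_le_bound _ (by positivity) fun y => ?_
  have h1 := h (toEuclideanLin Y y)
  rw [← toEuclideanLin_mul_apply, ← toEuclideanLin_mul_apply] at h1
  have h2 := (toEuclideanCLM (n := Fin n) (𝕜 := ℝ) (Z * Y)).le_opNorm y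
  rw [Matrix.l2_opNorm_toEuclideanCLM] at h2
  calc _ ≤ _ := h1
    _ ≤ C * (‖Z * Y‖ * ‖y‖) := mul_le_mul_of_nonneg_left h2 hC
    _ = _ := by ring

/-! ### Projectors and the spectral decomposition of `H Hᵀ` -/

namespace SignalSubspace

variable {L K : ℕ}

theorem projMatrix_apply (U : Submodule ℝ (EuclideanSpace ℝ (Fin L)))
    (y : EuclideanSpace ℝ (Fin L)) :
    Matrix.toEuclideanLin (projMatrix U) y = U.starProjection y := by
  rw [← Matrix.coe_toEuclideanCLM_eq_toEuclideanLin, projMatrix]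
  simp

theorem projMatrix_mul_self (U : Submodule ℝ (EuclideanSpace ℝ (Fin L))) :
    projMatrix U * projMatrix U = projMatrix U := by
  rw [projMatrix, ← map_mul, U.isIdempotentElem_starProjection.eq]

theorem projMatrix_transpose (U : Submodule ℝ (EuclideanSpace ℝ (Fin L))) :
    (projMatrix U)ᵀ = projMatrix U := by
  have h := map_star (Matrix.toEuclideanCLM (n := Fin L) (𝕜 := ℝ)) (projMatrix U)
  rw [projMatrix, StarAlgEquiv.apply_symm_apply,
    (isStarProjection_starProjection (U := U)).isSelfAdjoint.star_eq] at h
  rw [← Matrix.conjTranspose_eq_transpose_of_trivial, ← Matrix.star_eq_conjTranspose]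
  refine EquivLike.injective (Matrix.toEuclideanCLM (n := Fin L) (𝕜 := ℝ)) ?_
  rw [projMatrix, h, StarAlgEquiv.apply_symm_apply]

theorem norm_projMatrix_le (U : Submodule ℝ (EuclideanSpace ℝ (Fin L))) : ‖projMatrix U‖ ≤ 1 := by
  rw [← Matrix.l2_opNorm_toEuclideanCLM, projMatrix, StarAlgEquiv.apply_symm_apply]
  exact U.starProjection_norm_le

theorem one_sub_projMatrix (U : Submodule ℝ (EuclideanSpace ℝ (Fin L))) :
    1 - projMatrix U = projMatrix Uᗮ := by
  rw [projMatrix, projMatrix, U.starProjection_orthogonal', map_sub, map_one]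

/-- The eigenvalues of `M Mᵀ` in decreasing order. -/
noncomputable def gramEig (M : Matrix (Fin L) (Fin K) ℝ) : Fin L → ℝ :=
  (gram_isSymmetric M).eigenvalues finrank_euclideanSpace_fin

/-- An orthonormal basis of eigenvectors of `M Mᵀ`, ordered by decreasing eigenvalues. -/
noncomputable def gramBasis (M : Matrix (Fin L) (Fin K) ℝ) :
    OrthonormalBasis (Fin L) ℝ (EuclideanSpace ℝ (Fin L)) :=
  (gram_isSymmetric M).eigenvectorBasis finrank_euclideanSpace_fin

theorem gramEig_antitone (M : Matrix (Fin L) (Fin K) ℝ) : Antitone (gramEig M) :=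
  (gram_isSymmetric M).eigenvalues_antitone finrank_euclideanSpace_fin

theorem gram_apply_gramBasis (M : Matrix (Fin L) (Fin K) ℝ) (j : Fin L) :
    Matrix.toEuclideanLin (gram M) (gramBasis M j) = gramEig M j • gramBasis M j :=
  (gram_isSymmetric M).apply_eigenvectorBasis finrank_euclideanSpace_fin j

theorem gramEig_nonneg (M : Matrix (Fin L) (Fin K) ℝ) (j : Fin L) : 0 ≤ gramEig M j := by
  refine eigenvalue_nonneg_of_nonneg
    ((gram_isSymmetric M).hasEigenvalue_eigenvalues finrank_euclideanSpace_fin j) fun x => ?_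
  have := (Matrix.posSemidef_self_mul_conjTranspose M).re_dotProduct_nonneg x.ofLp
  have h2 := Matrix.inner_toEuclideanCLM (gram M) x x
  rw [gram] at h2
  rw [Matrix.conjTranspose_eq_transpose_of_trivial] at this
  change 0 ≤ inner ℝ x (Matrix.toEuclideanCLM (n := Fin L) (𝕜 := ℝ) (gram M) x)
  rw [gram, h2]
  simpa using this

theorem mem_posEig_iff (H : Matrix (Fin L) (Fin K) ℝ) (μ : ℝ) :
    μ ∈ posEig H ↔ 0 < μ ∧ ∃ j, gramEig H j = μ := by
  rw [posEig, Finset.mem_filter, Set.Finite.mem_toFinset, ← Matrix.spectrum_toLpLin 2,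
    ← Module.End.hasEigenvalue_iff_mem_spectrum, and_comm]
  refine and_congr_right fun _ => ⟨fun h => ?_, ?_⟩
  · exact (gram_isSymmetric H).exists_eigenvalues_eq finrank_euclideanSpace_fin h
  · rintro ⟨j, rfl⟩
    exact (gram_isSymmetric H).hasEigenvalue_eigenvalues finrank_euclideanSpace_fin j

theorem eigProj_apply_gramBasis (H : Matrix (Fin L) (Fin K) ℝ) (μ : ℝ) (j : Fin L) :
    Matrix.toEuclideanLin (eigProj H μ) (gramBasis H j)
      = if gramEig H j = μ then gramBasis H j else 0 := by
  rw [eigProj, projMatrix_apply]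
  split_ifs with h
  · rw [Submodule.starProjection_eq_self_iff, Module.End.mem_eigenspace_iff, gram_apply_gramBasis, h]
  · rw [Submodule.starProjection_apply_eq_zero_iff, Submodule.mem_orthogonal]
    intro u hu
    refine (gram_isSymmetric H).orthogonalFamily_eigenspaces (Ne.symm h) ⟨u, hu⟩ ⟨gramBasis H j, ?_⟩
    rw [Module.End.mem_eigenspace_iff, gram_apply_gramBasis]

theorem pinv_apply_gramBasis (H : Matrix (Fin L) (Fin K) ℝ) (j : Fin L) :
    Matrix.toEuclideanLin (pinv H) (gramBasis H j) = (gramEig H j)⁻¹ • gramBasis H j := by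
  simp only [pinv, map_sum, map_smul, LinearMap.sum_apply, LinearMap.smul_apply,
    eigProj_apply_gramBasis, smul_ite, smul_zero]
  rw [Finset.sum_ite_eq]
  split_ifs with h
  · rfl
  -- On the kernel both sides vanish, by the convention `0⁻¹ = 0`.
  · have : gramEig H j = 0 := by
      by_contra h0
      exact h ((mem_posEig_iff _ _).2 ⟨lt_of_le_of_ne (gramEig_nonneg _ _) (Ne.symm h0), j, rfl⟩)
    simp [this]

theorem sum_eigProj (H : Matrix (Fin L) (Fin K) ℝ) :
    ∑ μ ∈ posEig H, eigProj H μ = signalProj H := by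
  refine Matrix.ext_orthonormalBasis (gramBasis H) fun j => ?_
  simp only [signalProj, map_sum, map_sub, LinearMap.sum_apply, LinearMap.sub_apply,
    Matrix.toEuclideanLin_one_apply, eigProj_apply_gramBasis]
  rw [Finset.sum_ite_eq]
  by_cases h : gramEig H j = 0
  · simp [mem_posEig_iff, h]
  · simp [mem_posEig_iff, h, lt_of_le_of_ne (gramEig_nonneg _ _) (Ne.symm h)]

theorem pinv_mul_gram (H : Matrix (Fin L) (Fin K) ℝ) : pinv H * gram H = signalProj H := by
  refine Matrix.ext_orthonormalBasis (gramBasis H) fun j => ?_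
  simp only [signalProj, map_sub, LinearMap.sub_apply, Matrix.toEuclideanLin_one_apply,
    eigProj_apply_gramBasis, Matrix.toEuclideanLin_mul_apply, gram_apply_gramBasis, map_smul,
    pinv_apply_gramBasis]
  by_cases h : gramEig H j = 0 <;> simp [h]

theorem gram_mul_pinv (H : Matrix (Fin L) (Fin K) ℝ) : gram H * pinv H = signalProj H := by
  refine Matrix.ext_orthonormalBasis (gramBasis H) fun j => ?_
  simp only [signalProj, map_sub, LinearMap.sub_apply, Matrix.toEuclideanLin_one_apply,
    eigProj_apply_gramBasis, Matrix.toEuclideanLin_mul_apply, gram_apply_gramBasis, map_smul,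
    pinv_apply_gramBasis]
  by_cases h : gramEig H j = 0 <;> simp [h]

theorem gram_mul_eigProj (H : Matrix (Fin L) (Fin K) ℝ) (μ : ℝ) :
    gram H * eigProj H μ = μ • eigProj H μ := by
  refine Matrix.ext_orthonormalBasis (gramBasis H) fun j => ?_
  simp only [map_smul, LinearMap.smul_apply,
    eigProj_apply_gramBasis, Matrix.toEuclideanLin_mul_apply]
  by_cases h : gramEig H j = μ <;> simp [h, gram_apply_gramBasis]

theorem eigProj_mul_eigProj (H : Matrix (Fin L) (Fin K) ℝ) (μ ν : ℝ) :
    eigProj H μ * eigProj H ν = if μ = ν then eigProj H μ else 0 := by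
  refine Matrix.ext_orthonormalBasis (gramBasis H) fun j => ?_
  simp only [eigProj_apply_gramBasis, Matrix.toEuclideanLin_mul_apply]
  by_cases h : gramEig H j = ν
  · subst h
    by_cases h' : μ = gramEig H j
    · subst h'; simp [eigProj_apply_gramBasis]
    · simp [h', Ne.symm h', eigProj_apply_gramBasis]
  · by_cases h' : μ = ν
    · subst h'; simp [h, eigProj_apply_gramBasis]
    · simp [h, h']

theorem pinv_mul_eigProj_zero (H : Matrix (Fin L) (Fin K) ℝ) : pinv H * eigProj H 0 = 0 := by
  refine Matrix.ext_orthonormalBasis (gramBasis H) fun j => ?_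
  simp only [eigProj_apply_gramBasis, Matrix.toEuclideanLin_mul_apply]
  by_cases h : gramEig H j = 0 <;> simp [h, pinv_apply_gramBasis]

theorem pinv_mul_signalProj (H : Matrix (Fin L) (Fin K) ℝ) :
    pinv H * signalProj H = pinv H := by
  rw [signalProj, mul_sub, mul_one, pinv_mul_eigProj_zero, sub_zero]

/-- Rank–nullity for `H Hᵀ` gives exactly `rank H` positive eigenvalues, and decreasing order makes
them an initial segment of the indices. -/
theorem gramEig_pos_iff (H : Matrix (Fin L) (Fin K) ℝ) (j : Fin L) :
    0 < gramEig H j ↔ (j : ℕ) < H.rank := by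
  have hker : Module.finrank ℝ (Module.End.eigenspace (Matrix.toEuclideanLin (gram H)) 0)
      + H.rank = L := by
    have h := LinearMap.finrank_range_add_finrank_ker (Matrix.toEuclideanLin (gram H))
    have hr : Module.finrank ℝ (LinearMap.range (Matrix.toEuclideanLin (gram H))) = H.rank := by
      rw [← Matrix.rank_self_mul_transpose]
      exact ((H * Hᵀ).rank_eq_finrank_range_toLin (PiLp.basisFun 2 ℝ (Fin L))
        (PiLp.basisFun 2 ℝ (Fin L))).symm
    rw [hr, finrank_euclideanSpace_fin] at h
    rw [Module.End.eigenspace_zero]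
    omega
  have hcard : (Finset.univ.filter fun k => 0 < gramEig H k).card = H.rank := by
    have h0 := (gram_isSymmetric H).card_filter_eigenvalues_eq finrank_euclideanSpace_fin 0
    have h1 := Finset.card_filter_add_card_filter_not (s := Finset.univ) fun k => 0 < gramEig H k
    have h2 : (Finset.univ.filter fun k => ¬ 0 < gramEig H k)
        = Finset.univ.filter fun k => gramEig H k = 0 := by
      refine Finset.filter_congr fun k _ => ?_
      rw [not_lt]
      exact ⟨fun h => le_antisymm h (gramEig_nonneg H k), fun h => h.le⟩
    change (Finset.univ.filter fun k => gramEig H k = 0).card = _ at h0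
    rw [h2, h0, Finset.card_univ, Fintype.card_fin] at h1
    omega
  constructor
  · intro hj
    have : Finset.Iic j ⊆ Finset.univ.filter fun k => 0 < gramEig H k := fun k hk => by
      simpa using hj.trans_le (gramEig_antitone H (Finset.mem_Iic.1 hk))
    have := Finset.card_le_card this
    rw [hcard, Fin.card_Iic] at this
    omega
  · intro hj
    by_contra hn
    have : (Finset.univ.filter fun k => 0 < gramEig H k) ⊆ Finset.Iio j := fun k hk => by
      rw [Finset.mem_Iio]
      by_contra hk'
      exact hn ((Finset.mem_filter.1 hk).2.trans_le (gramEig_antitone H (not_lt.1 hk')))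
    have := Finset.card_le_card this
    rw [hcard, Fin.card_Iio] at this
    omega

theorem posEig_nonempty {H : Matrix (Fin L) (Fin K) ℝ} (hH : H ≠ 0) : (posEig H).Nonempty := by
  by_contra hne
  apply hH
  have : gram H = 0 := by
    refine Matrix.ext_orthonormalBasis (gramBasis H) fun j => ?_
    have : gramEig H j = 0 := by
      by_contra h0
      exact hne ⟨_, (mem_posEig_iff _ _).2
        ⟨lt_of_le_of_ne (gramEig_nonneg _ _) (Ne.symm h0), j, rfl⟩⟩
    rw [gram_apply_gramBasis, this]
    simp
  rw [gram, ← Matrix.conjTranspose_eq_transpose_of_trivial,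
    Matrix.self_mul_conjTranspose_eq_zero] at this
  exact this

theorem muMin_pos {H : Matrix (Fin L) (Fin K) ℝ} (hH : H ≠ 0) : 0 < muMin H := by
  have := (posEig_nonempty hH).csInf_mem
  exact ((mem_posEig_iff _ _).1 this).1

theorem muMin_le {H : Matrix (Fin L) (Fin K) ℝ} {μ : ℝ} (h : μ ∈ posEig H) : muMin H ≤ μ :=
  csInf_le (posEig H).finite_toSet.bddBelow h

theorem muMin_le_gramEig {H : Matrix (Fin L) (Fin K) ℝ} {j : Fin L} (h : 0 < gramEig H j) :
    muMin H ≤ gramEig H j :=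
  muMin_le ((mem_posEig_iff _ _).2 ⟨h, j, rfl⟩)

theorem norm_pinv_mul_le {H : Matrix (Fin L) (Fin K) ℝ} (hH : H ≠ 0)
    (Y : Matrix (Fin L) (Fin L) ℝ) : ‖pinv H * Y‖ ≤ ‖Y‖ / muMin H := by
  have hμ := muMin_pos hH
  have := Matrix.l2_opNorm_mul_le_of_apply (X := pinv H) (Z := 1) (C := (muMin H)⁻¹)
    (by positivity) (norm_apply_le_of_diagonal (gramBasis H) _ _ (fun j => (gramEig H j)⁻¹) 1 _
      (by positivity) (pinv_apply_gramBasis H)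
      (fun j => by simp) fun j => ?_) Y
  · rw [one_mul] at this
    rwa [div_eq_inv_mul]
  · rcases (gramEig_nonneg H j).eq_or_lt with h | h
    · simp [← h, hμ.le]
    · simpa [abs_of_pos h] using inv_anti₀ hμ (muMin_le_gramEig h)

end SignalSubspace

/-! ### The perturbation estimate in a C*-ring -/

-- The analytic core, free of eigenvalues: the spectrum enters only through `hlow` and `hhigh`, the
-- series only through the equation `hT`.
set_option maxHeartbeats 1000000 in
theorem CStarRing.norm_projection_sub_le {R : Type*} [NormedRing R] [StarRing R] [CStarRing R]
    {A B S P Q T : R} {m : ℝ} (hm : 0 < m) (hB : 4 * ‖B‖ < m)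
    (hP : P * P = P) (hPs : star P = P) (hQ : Q * Q = Q) (hQs : star Q = Q)
    (nP : ‖P‖ ≤ 1) (nP' : ‖1 - P‖ ≤ 1) (nQ : ‖Q‖ ≤ 1) (nQ' : ‖1 - Q‖ ≤ 1)
    (hAP : A * P = 0) (hSA : S * A = 1 - P) (hAS : A * S = 1 - P) (hSP : S * P = 0)
    (nS : ‖S‖ ≤ m⁻¹) (hcomm : (A + B) * Q = Q * (A + B))
    (hlow : ‖(A + B) * (1 - Q)‖ ≤ ‖B‖)
    (hhigh : (m - ‖B‖) * ‖Q * P‖ ≤ ‖(A + B) * (Q * P)‖)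
    (hT : T = S * (B * P - B * T + T * (P * B * P))) :
    ‖Q - (1 - P) - (T + star T)‖ ≤ 8 * (‖S * B * P‖ ^ 2 / (1 - 4 * ‖B‖ / m)) := by
  have hP₂ : ∀ X, P * (P * X) = P * X := fun X => by rw [← mul_assoc, hP]
  have hQ₂ : ∀ X, Q * (Q * X) = Q * X := fun X => by rw [← mul_assoc, hQ]
  have hSP₂ : ∀ X, S * (P * X) = 0 := fun X => by rw [← mul_assoc, hSP, zero_mul]
  obtain ⟨x, hx⟩ : ∃ x, x = ‖B‖ / m := ⟨_, rfl⟩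
  have hx0 : 0 ≤ x := by rw [hx]; positivity
  have hx4 : x < 1 / 4 := by rw [hx, div_lt_iff₀ hm]; linarith
  set V := (1 - P) * Q * P with hV
  set a := (1 - P) * (1 - Q) * (1 - P) with ha
  set b := P * Q * P with hb
  set W := V - T with hW
  set s := ‖S * B * P‖ with hs
  have bound : ∀ X Y : R, ‖X‖ ≤ ‖B‖ → ‖S * X * Y‖ ≤ x * ‖Y‖ := by
    intro X Y hX
    have h1 : ‖S * X‖ ≤ x := by
      refine (norm_mul_le _ _).trans ?_
      rw [hx, div_eq_inv_mul]
      exact mul_le_mul nS hX (norm_nonneg _) (by positivity)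
    exact (norm_mul_le _ _).trans (mul_le_mul_of_nonneg_right h1 (norm_nonneg _))
  have hBP : ‖B * P‖ ≤ ‖B‖ :=
    (norm_mul_le _ _).trans (mul_le_of_le_one_right (norm_nonneg _) nP)
  have hPBP : ‖P * B * P‖ ≤ ‖B‖ := by
    rw [mul_assoc]
    exact (norm_mul_le _ _).trans ((mul_le_of_le_one_left (norm_nonneg _) nP).trans hBP)
  have bound' : ∀ X Y : R, ‖X‖ ≤ ‖B‖ → ‖S * (Y * X)‖ ≤ x * ‖Y‖ := by
    intro X Y hX
    refine (norm_mul_le _ _).trans ?_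
    have h1 : ‖Y * X‖ ≤ ‖Y‖ * ‖B‖ :=
      (norm_mul_le _ _).trans (mul_le_mul_of_nonneg_left hX (norm_nonneg _))
    calc ‖S‖ * ‖Y * X‖ ≤ m⁻¹ * (‖Y‖ * ‖B‖) :=
          mul_le_mul nS h1 (norm_nonneg _) (by positivity)
      _ = x * ‖Y‖ := by rw [hx]; ring
  have hVeq : V = S * B * P - S * (a * (B * P)) + S * (V * (P * B * P)) - S * B * V
      - S * B * P * b := by
    -- Replace `1 - P` by `SA`, move `A` across `Q` by commutation, and use `AP = 0`. Splitting `Q`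
    -- into blocks then yields `hVeq`.
    have h1 : V = S * (Q * B - B * Q) * P := by
      have h2 : A * Q = Q * A + Q * B - B * Q := by
        rw [← mul_add, ← hcomm]; noncomm_ring
      have h3 : S * (A * Q) * P = S * (Q * A + Q * B - B * Q) * P := by rw [h2]
      rw [hV, ← hSA, mul_assoc S A Q, h3]
      simp only [mul_sub, sub_mul, mul_add, add_mul, mul_assoc, hAP, mul_zero]
      abel
    refine h1.trans ?_
    rw [ha, hV, hb]
    simp only [mul_sub, sub_mul, mul_one, one_mul, mul_assoc, hP, hP₂, hSP₂]
    abel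
  have hWeq : W = S * (W * (P * B * P)) - S * B * W - S * (a * (B * P)) - S * B * P * b := by
    have : W = (S * B * P - S * (a * (B * P)) + S * (V * (P * B * P)) - S * B * V
      - S * B * P * b) - S * (B * P - B * T + T * (P * B * P)) := by rw [← hT, ← hVeq]
    refine this.trans ?_
    rw [hW]
    noncomm_ring
  have hsV : star V = P * Q * (1 - P) := by
    simp only [hV, star_mul, star_sub, star_one, hPs, hQs, mul_assoc]
  -- The `P`-corner of `Q = Q²`; `haeq` is the complementary corner of `1 - Q = (1 - Q)²`.
  have hbeq : b = b * b + star V * V := by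
    rw [hsV, hb, hV]
    simp only [mul_sub, sub_mul, mul_one, one_mul, mul_assoc, hP₂, hQ₂]
    abel
  have haeq : a = a * a + V * star V := by
    rw [hsV, ha, hV]
    simp only [mul_sub, sub_mul, mul_one, one_mul, mul_assoc, hP, hP₂, hQ, hQ₂]
    abel
  have hQP : ‖Q * P‖ ≤ 1 / 3 := by
    have h1 : (A + B) * (Q * P) = Q * (B * P) := by
      rw [← mul_assoc, hcomm, mul_assoc, add_mul, hAP, zero_add]
    have h2 : ‖Q * (B * P)‖ ≤ ‖B‖ :=
      (norm_mul_le _ _).trans ((mul_le_of_le_one_left (norm_nonneg _) nQ).trans hBP)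
    rw [h1] at hhigh
    nlinarith [norm_nonneg (Q * P)]
  have hNP : ‖(1 - Q) * (1 - P)‖ ≤ 1 / 2 := by
    -- Here `1 - P = AS` and `A = (A + B) - B`.
    have h1 : (1 - Q) * (1 - P) = ((A + B) * (1 - Q) - (1 - Q) * B) * S := by
      have h2 : (A + B) * (1 - Q) = (1 - Q) * (A + B) := by
        rw [mul_sub, sub_mul, hcomm, mul_one, one_mul]
      rw [h2, ← hAS]
      noncomm_ring
    have h2 : ‖(1 - Q) * B‖ ≤ ‖B‖ :=
      (norm_mul_le _ _).trans (mul_le_of_le_one_left (norm_nonneg _) nQ')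
    have h3 : ‖(A + B) * (1 - Q) - (1 - Q) * B‖ ≤ 2 * ‖B‖ := (norm_sub_le _ _).trans (by linarith)
    rw [h1]
    calc _ ≤ _ := norm_mul_le _ _
      _ ≤ (2 * ‖B‖) * m⁻¹ := mul_le_mul h3 nS (norm_nonneg _) (by positivity)
      _ = 2 * x := by rw [hx]; ring
      _ ≤ 1 / 2 := by linarith
  have hbn : ‖b‖ ≤ 1 / 9 := by
    have h1 : b = star (Q * P) * (Q * P) := by
      rw [star_mul, hPs, hQs, mul_assoc, hQ₂, hb, mul_assoc]
    rw [h1, CStarRing.norm_star_mul_self]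
    nlinarith [norm_nonneg (Q * P)]
  have han : ‖a‖ ≤ 1 / 4 := by
    have h1 : a = star ((1 - Q) * (1 - P)) * ((1 - Q) * (1 - P)) := by
      simp only [ha, star_mul, star_sub, star_one, hPs, hQs, mul_sub, sub_mul, mul_one, one_mul,
        mul_assoc, hQ₂, hQ]
      abel
    rw [h1, CStarRing.norm_star_mul_self]
    nlinarith [norm_nonneg ((1 - Q) * (1 - P))]
  have hVn : ‖V‖ ≤ 1 / 3 := by
    rw [hV, mul_assoc]
    exact (norm_mul_le _ _).trans ((mul_le_of_le_one_left (norm_nonneg _) nP').trans hQP)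
  -- From `‖b‖ (1 - ‖b‖) ≤ ‖V‖²`; the a priori bound `‖b‖ ≤ 1/9` selects the small branch. For `a`,
  -- the bound `1/4` gives `4/3`.
  have hbV : ‖b‖ ≤ 9 / 8 * ‖V‖ ^ 2 := by
    have h1 : ‖b‖ ≤ ‖b‖ * ‖b‖ + ‖V‖ * ‖V‖ := by
      rw [← CStarRing.norm_star_mul_self (x := V)]
      conv_lhs => rw [hbeq]
      exact (norm_add_le _ _).trans (add_le_add_left (norm_mul_le _ _) _)
    nlinarith [norm_nonneg b]
  have haV : ‖a‖ ≤ 4 / 3 * ‖V‖ ^ 2 := by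
    have h1 : ‖a‖ ≤ ‖a‖ * ‖a‖ + ‖V‖ * ‖V‖ := by
      rw [← CStarRing.norm_self_mul_star (x := V)]
      conv_lhs => rw [haeq]
      exact (norm_add_le _ _).trans (add_le_add_left (norm_mul_le _ _) _)
    nlinarith [norm_nonneg a]
  have hab := bound' (B * P) a hBP
  have hsb : ‖S * B * P * b‖ ≤ s * ‖b‖ := norm_mul_le _ _
  -- `22/9 = 2 + 4/9`: two linear terms in `V`, and `‖a‖ ≤ (4/3)‖V‖² ≤ (4/9)‖V‖` because `‖V‖ ≤
  -- 1/3`.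
  have hVs : ‖V‖ * (1 - 22 / 9 * x) ≤ 9 / 8 * s := by
    have h1 : ‖V‖ ≤ s + x * ‖a‖ + x * ‖V‖ + x * ‖V‖ + s * ‖b‖ := by
      conv_lhs => rw [hVeq]
      refine (norm_sub_le _ _).trans (add_le_add ((norm_sub_le _ _).trans (add_le_add
        ((norm_add_le _ _).trans (add_le_add ((norm_sub_le _ _).trans (add_le_add le_rfl hab))
          (bound' _ _ hPBP))) (bound _ _ le_rfl))) hsb)
    have h2 : ‖a‖ ≤ 4 / 9 * ‖V‖ := by nlinarith [norm_nonneg V]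
    have h3 : x * ‖a‖ ≤ x * (4 / 9 * ‖V‖) := mul_le_mul_of_nonneg_left h2 hx0
    have h4 : s * ‖b‖ ≤ s * (1 / 8) :=
      mul_le_mul_of_nonneg_left (hbn.trans (by norm_num)) (norm_nonneg _)
    linarith
  -- `x / (1 - 2x) ≤ 1/2` for `x < 1/4`, and `4/3 + 9/8 = 59/24`.
  have hWn : ‖W‖ ≤ 59 / 48 * ‖V‖ ^ 2 := by
    have h1 : ‖W‖ ≤ x * ‖W‖ + x * ‖W‖ + x * ‖a‖ + x * ‖b‖ := by
      conv_lhs => rw [hWeq]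
      refine (norm_sub_le _ _).trans (add_le_add ((norm_sub_le _ _).trans (add_le_add
        ((norm_sub_le _ _).trans (add_le_add (bound' _ _ hPBP) (bound _ _ le_rfl))) hab)) ?_)
      rw [mul_assoc S B P]
      exact bound _ _ hBP
    nlinarith [norm_nonneg W, norm_nonneg a, norm_nonneg b]
  have htot : ‖Q - (1 - P) - (T + star T)‖ ≤ 59 / 12 * ‖V‖ ^ 2 := by
    have h1 : Q - (1 - P) - (T + star T) = -a + b + W + star W := by
      rw [hW, star_sub, hsV, ha, hb, hV]
      simp only [mul_sub, sub_mul, mul_one, one_mul, mul_assoc, hP]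
      abel
    rw [h1]
    have h2 : ‖-a + b + W + star W‖ ≤ ‖a‖ + ‖b‖ + ‖W‖ + ‖W‖ := by
      refine (norm_add_le _ _).trans (add_le_add ((norm_add_le _ _).trans (add_le_add
        ((norm_add_le _ _).trans (add_le_add (norm_neg _).le le_rfl)) le_rfl)) (norm_star _).le)
    linarith
  have h4x : 4 * ‖B‖ / m = 4 * x := by rw [hx]; ring
  have hs0 : 0 ≤ s := norm_nonneg _
  have hsq : (‖V‖ * (1 - 22 / 9 * x)) ^ 2 ≤ (9 / 8 * s) ^ 2 :=
    pow_le_pow_left₀ (mul_nonneg (norm_nonneg _) (by linarith)) hVs 2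
  -- The difference is a quadratic with negative discriminant and minimum near `x = 1/11`. The final
  -- constant is `59/12 · 81/64 · 20/19 < 8`.
  have hkey : 19 / 20 * (1 - 4 * x) ≤ (1 - 22 / 9 * x) ^ 2 := by
    nlinarith [sq_nonneg (x - 1 / 11)]
  rw [h4x, ← mul_div_assoc, le_div_iff₀ (by linarith)]
  have h5 : ‖V‖ ^ 2 * (19 / 20 * (1 - 4 * x)) ≤ 81 / 64 * s ^ 2 :=
    (mul_le_mul_of_nonneg_left hkey (sq_nonneg _)).trans (by nlinarith)
  have h6 := mul_le_mul_of_nonneg_right htot (by linarith : 0 ≤ 1 - 4 * x)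
  nlinarith [sq_nonneg s]

/-! ### Structure and size of the perturbation -/

namespace SignalSubspace

variable {L K : ℕ}

theorem eigProj_zero_mul_gram (H : Matrix (Fin L) (Fin K) ℝ) : eigProj H 0 * gram H = 0 := by
  have h := congrArg Matrix.transpose (gram_mul_eigProj H 0)
  have hg : (gram H)ᵀ = gram H := by simp [gram]
  have hp : (eigProj H 0)ᵀ = eigProj H 0 := projMatrix_transpose _
  rw [Matrix.transpose_mul, hg, zero_smul, Matrix.transpose_zero, hp] at h
  exact h

theorem eigProj_zero_mul (H : Matrix (Fin L) (Fin K) ℝ) : eigProj H 0 * H = 0 := by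
  have h := eigProj_zero_mul_gram H
  rw [gram, ← Matrix.conjTranspose_eq_transpose_of_trivial,
    Matrix.mul_self_mul_conjTranspose_eq_zero] at h
  exact h

theorem transpose_mul_eigProj_zero (H : Matrix (Fin L) (Fin K) ℝ) : Hᵀ * eigProj H 0 = 0 := by
  have hp : (eigProj H 0)ᵀ = eigProj H 0 := projMatrix_transpose _
  have h := congrArg Matrix.transpose (eigProj_zero_mul H)
  rwa [Matrix.transpose_mul, hp, Matrix.transpose_zero] at h

theorem gram_add_smul (H E : Matrix (Fin L) (Fin K) ℝ) (δ : ℝ) :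
    gram (H + δ • E) = gram H + pert H E δ := by
  simp only [gram, pert, A₁, A₂, Matrix.transpose_add, Matrix.transpose_smul, Matrix.mul_add,
    Matrix.add_mul, Matrix.mul_smul, Matrix.smul_mul, smul_add, smul_smul, pow_two]
  abel

/-- The first-order part drops out because `P₀ H = 0` and `Hᵀ P₀ = 0`. -/
theorem eigProj_mul_pert_mul_eigProj (H E : Matrix (Fin L) (Fin K) ℝ) (δ : ℝ) :
    eigProj H 0 * pert H E δ * eigProj H 0 = δ ^ 2 • A₂₀ H E := by
  have h1 : eigProj H 0 * A₁ H E * eigProj H 0 = 0 := by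
    rw [A₁, mul_add, add_mul, ← Matrix.mul_assoc, eigProj_zero_mul, ← Matrix.mul_assoc,
      Matrix.mul_assoc _ Hᵀ, transpose_mul_eigProj_zero]
    simp
  rw [pert, mul_add, add_mul, mul_smul_comm, smul_mul_assoc, h1, smul_zero, zero_add, A₂₀,
    mul_smul_comm, smul_mul_assoc]

theorem norm_pert_le (H E : Matrix (Fin L) (Fin K) ℝ) (δ : ℝ) :
    ‖pert H E δ‖ ≤ pertBound H E δ := by
  refine (norm_add_le _ _).trans (le_of_eq ?_)
  rw [norm_smul, norm_smul, pertBound, Real.norm_eq_abs, Real.norm_eq_abs, abs_pow, sq_abs]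

theorem pertBound_lt {E : Matrix (Fin L) (Fin K) ℝ} (hE : E ≠ 0) (H : Matrix (Fin L) (Fin K) ℝ)
    {δ δ₀ : ℝ} (hδ : |δ| < δ₀) : pertBound H E δ < pertBound H E δ₀ := by
  have hA : 0 < ‖A₂ E‖ := by
    rw [norm_pos_iff, A₂, ← Matrix.conjTranspose_eq_transpose_of_trivial, Ne,
      Matrix.self_mul_conjTranspose_eq_zero]
    exact hE
  have h0 : δ₀ = |δ₀| := (abs_of_pos ((abs_nonneg δ).trans_lt hδ)).symm
  have h1 : δ ^ 2 < δ₀ ^ 2 := sq_lt_sq.2 (h0 ▸ hδ)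
  rw [h0] at hδ
  exact add_lt_add_of_le_of_lt (mul_le_mul_of_nonneg_right hδ.le (norm_nonneg _))
    (mul_lt_mul_of_pos_right h1 hA)

theorem norm_signalProj_le (H : Matrix (Fin L) (Fin K) ℝ) : ‖signalProj H‖ ≤ 1 := by
  rw [signalProj, eigProj, one_sub_projMatrix]
  exact norm_projMatrix_le _

theorem norm_eigProj_mul_pert_mul_eigProj_le (H E : Matrix (Fin L) (Fin K) ℝ) (δ : ℝ) :
    ‖eigProj H 0 * pert H E δ * eigProj H 0‖ ≤ ‖pert H E δ‖ := by
  have h : ‖eigProj H 0‖ ≤ 1 := norm_projMatrix_le _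
  refine (norm_mul_le _ _).trans ((mul_le_of_le_one_right (norm_nonneg _) h).trans ?_)
  exact (norm_mul_le _ _).trans (mul_le_of_le_one_left (norm_nonneg _) h)

/-! ### The Sylvester inverse and the series `T₁` -/

theorem isUnit_resArg {H E : Matrix (Fin L) (Fin K) ℝ} {δ μ : ℝ} (hμ : 0 < μ)
    (h : ‖pert H E δ‖ < μ) : IsUnit (resArg H E δ μ) := by
  refine isUnit_one_sub_of_norm_lt_one ?_
  rw [div_eq_inv_mul, mul_smul, ← eigProj_mul_pert_mul_eigProj, norm_smul, norm_inv,
    Real.norm_of_nonneg hμ.le, inv_mul_lt_iff₀ hμ, mul_one]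
  exact (norm_eigProj_mul_pert_mul_eigProj_le H E δ).trans_lt h

/-- The map `Y ↦ ∑_{μ > 0} P_μ Y (I - δ² A₀⁽²⁾ / μ)⁻¹ / μ`, which inverts the Sylvester operator
`Z ↦ A Z - δ² Z A₀⁽²⁾` on the matrices with columns in the range of `A`. -/
noncomputable def sylvesterInv (H E : Matrix (Fin L) (Fin K) ℝ) (δ : ℝ) :
    Matrix (Fin L) (Fin L) ℝ →ₗ[ℝ] Matrix (Fin L) (Fin L) ℝ where
  toFun Y := ∑ μ ∈ posEig H, μ⁻¹ • (eigProj H μ * Y * (resArg H E δ μ)⁻¹)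
  map_add' X Y := by
    simp only [mul_add, add_mul, smul_add, Finset.sum_add_distrib]
  map_smul' c Y := by
    simp only [mul_smul_comm, smul_mul_assoc, RingHom.id_apply, Finset.smul_sum, smul_comm c]

theorem sylvesterInv_apply (H E : Matrix (Fin L) (Fin K) ℝ) (δ : ℝ)
    (Y : Matrix (Fin L) (Fin L) ℝ) : sylvesterInv H E δ Y
      = ∑ μ ∈ posEig H, μ⁻¹ • (eigProj H μ * Y * (resArg H E δ μ)⁻¹) := rfl

/-- Cancelling the resolvent in each component gives `P_μ Z = μ⁻¹ P_μ (Y + Z D)`; summing over `μ`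
assembles `pinv H`. This form lets norms be bounded through `pinv H`, with no factor counting
eigenvalues. -/
theorem sylvesterInv_eq {H E : Matrix (Fin L) (Fin K) ℝ} {δ : ℝ}
    (h : ∀ μ ∈ posEig H, IsUnit (resArg H E δ μ)) (Y : Matrix (Fin L) (Fin L) ℝ) :
    sylvesterInv H E δ Y = pinv H *
      (Y + sylvesterInv H E δ Y * (eigProj H 0 * pert H E δ * eigProj H 0)) := by
  set Z := sylvesterInv H E δ Y with hZ
  set D := eigProj H 0 * pert H E δ * eigProj H 0 with hD
  have hP : ∀ μ ∈ posEig H, eigProj H μ * Z = μ⁻¹ • (eigProj H μ * Y * (resArg H E δ μ)⁻¹) := by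
    intro μ hμ
    rw [hZ, sylvesterInv_apply, Finset.mul_sum, Finset.sum_eq_single_of_mem μ hμ]
    · rw [mul_smul_comm, ← mul_assoc, ← mul_assoc, eigProj_mul_eigProj, if_pos rfl]
    · intro ν _ hν
      rw [mul_smul_comm, ← mul_assoc, ← mul_assoc, eigProj_mul_eigProj, if_neg hν.symm]
      simp
  have hP' : ∀ μ ∈ posEig H, eigProj H μ * Z = μ⁻¹ • eigProj H μ * (Y + Z * D) := by
    intro μ hμ
    have h1 : eigProj H μ * Z * resArg H E δ μ = μ⁻¹ • (eigProj H μ * Y) := by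
      rw [hP μ hμ, smul_mul_assoc, mul_assoc,
        Matrix.nonsing_inv_mul _ ((Matrix.isUnit_iff_isUnit_det _).1 (h μ hμ)), mul_one]
    rw [resArg, div_eq_inv_mul, mul_smul, ← eigProj_mul_pert_mul_eigProj, ← hD, mul_sub, mul_one,
      sub_eq_iff_eq_add, mul_smul_comm] at h1
    rw [h1, smul_mul_assoc, mul_add, smul_add, mul_assoc]
  have hZS : signalProj H * Z = Z := by
    rw [← sum_eigProj, Finset.sum_mul, Finset.sum_congr rfl hP]
    rfl
  conv_lhs => rw [← hZS, ← sum_eigProj, Finset.sum_mul, Finset.sum_congr rfl hP']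
  rw [pinv, Finset.sum_mul]

/-- The unknown `Z` on the right of `sylvesterInv_eq` is absorbed: `(m - ‖B‖)‖Z‖ ≤ ‖B‖‖Y‖`, and `‖B‖
/ (m - ‖B‖) < 1/3`. -/
theorem norm_sylvesterInv_pert_mul_le {H E : Matrix (Fin L) (Fin K) ℝ} {δ : ℝ} (hH : H ≠ 0)
    (hB : 4 * ‖pert H E δ‖ < muMin H) (h : ∀ μ ∈ posEig H, IsUnit (resArg H E δ μ))
    (Y : Matrix (Fin L) (Fin L) ℝ) :
    ‖sylvesterInv H E δ (pert H E δ * Y)‖ ≤ 1 / 3 * ‖Y‖ := by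
  set Z := sylvesterInv H E δ (pert H E δ * Y) with hZ
  have h1 := norm_pinv_mul_le hH
    (pert H E δ * Y + Z * (eigProj H 0 * pert H E δ * eigProj H 0))
  rw [hZ, ← sylvesterInv_eq h, ← hZ, le_div_iff₀ (muMin_pos hH)] at h1
  have h2 : ‖pert H E δ * Y + Z * (eigProj H 0 * pert H E δ * eigProj H 0)‖
      ≤ ‖pert H E δ‖ * ‖Y‖ + ‖Z‖ * ‖pert H E δ‖ :=
    (norm_add_le _ _).trans (add_le_add (norm_mul_le _ _) ((norm_mul_le _ _).trans
      (mul_le_mul_of_nonneg_left (norm_eigProj_mul_pert_mul_eigProj_le H E δ) (norm_nonneg _))))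
  have h3 := muMin_pos hH
  have h4 : muMin H * ‖Z‖ ≤ muMin H * (1 / 3 * ‖Y‖) := by
    nlinarith [norm_nonneg Y, norm_nonneg Z]
  exact le_of_mul_le_mul_left h4 h3

theorem commute_resArg_inv (H E : Matrix (Fin L) (Fin K) ℝ) (δ μ ν : ℝ) :
    Commute (resArg H E δ μ)⁻¹ (resArg H E δ ν)⁻¹ := by
  rw [Matrix.nonsing_inv_eq_ringInverse, Matrix.nonsing_inv_eq_ringInverse]
  refine Commute.ringInverse_ringInverse ?_
  refine Commute.sub_left (Commute.one_left _) (Commute.sub_right (Commute.one_right _) ?_)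
  exact ((Commute.refl (A₂₀ H E)).smul_left _).smul_right _

theorem T₁term_zero (H E : Matrix (Fin L) (Fin K) ℝ) (δ : ℝ) : T₁term H E δ 0 = L₁ H E δ := by
  simp [T₁term, J, G]

theorem L₁_eq (H E : Matrix (Fin L) (Fin K) ℝ) (δ : ℝ) :
    L₁ H E δ = sylvesterInv H E δ (pert H E δ * eigProj H 0) := by
  simp only [L₁, sylvesterInv_apply, smul_mul_assoc, mul_assoc]

/-- The index `μ₁` is split off. Its factor stands leftmost in `J`, but its resolvent must become
rightmost in `G`, which is possible because the resolvents commute. -/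
theorem T₁term_succ (H E : Matrix (Fin L) (Fin K) ℝ) (δ : ℝ) (i : ℕ) :
    T₁term H E δ (i + 1) = -sylvesterInv H E δ (pert H E δ * T₁term H E δ i) := by
  rw [T₁term, T₁term, mul_smul_comm, map_smul, pow_succ, mul_neg_one, neg_smul, Finset.mul_sum,
    map_sum]
  congr 2
  simp only [sylvesterInv_apply]
  rw [← Finset.sum_product']
  refine Finset.sum_nbij' (fun m => (Fin.tail m, m 0)) (fun p => Fin.cons p.2 p.1)
    (fun m hm => ?_) (fun p hp => ?_) (fun m _ => Fin.cons_self_tail m) (fun p _ => by simp)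
    fun m _ => ?_
  · rw [Fintype.mem_piFinset] at hm
    exact Finset.mem_product.2 ⟨Fintype.mem_piFinset.2 fun k => hm k.succ, hm 0⟩
  · rw [Finset.mem_product, Fintype.mem_piFinset] at hp
    rw [Fintype.mem_piFinset]
    exact Fin.cases hp.2 hp.1
  · have hJ : J H E δ m = (m 0)⁻¹ • (eigProj H (m 0) * pert H E δ) * J H E δ (Fin.tail m) := by
      simp only [J, List.ofFn_succ, List.prod_cons, Fin.tail]
    have hG : G H E δ m = G H E δ (Fin.tail m) * (resArg H E δ (m 0))⁻¹ := by
      have : G H E δ m = (resArg H E δ (m 0))⁻¹ * G H E δ (Fin.tail m) := by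
        simp only [G, List.ofFn_succ, List.prod_cons, Fin.tail]
      rw [this]
      refine Commute.list_prod_right _ _ fun x hx => ?_
      obtain ⟨k, rfl⟩ := (List.mem_ofFn' _ _).1 hx
      exact commute_resArg_inv H E δ _ _
    rw [hJ, hG]
    simp only [smul_mul_assoc, mul_assoc]

theorem norm_T₁term_le {H E : Matrix (Fin L) (Fin K) ℝ} {δ : ℝ} (hH : H ≠ 0)
    (hB : 4 * ‖pert H E δ‖ < muMin H) (h : ∀ μ ∈ posEig H, IsUnit (resArg H E δ μ)) (i : ℕ) :
    ‖T₁term H E δ i‖ ≤ (1 / 3) ^ i * ‖L₁ H E δ‖ := by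
  induction i with
  | zero => simp [T₁term_zero]
  | succ i ih =>
    rw [T₁term_succ, norm_neg, pow_succ']
    have := norm_sylvesterInv_pert_mul_le hH hB h (T₁term H E δ i)
    linarith

theorem summable_T₁term {H E : Matrix (Fin L) (Fin K) ℝ} {δ : ℝ} (hH : H ≠ 0)
    (hB : 4 * ‖pert H E δ‖ < muMin H) (h : ∀ μ ∈ posEig H, IsUnit (resArg H E δ μ)) :
    Summable (T₁term H E δ) :=
  Summable.of_norm_bounded ((summable_geometric_of_lt_one (by norm_num) (by norm_num)).mul_right _)
    (norm_T₁term_le hH hB h)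

/-- Summing the recursion gives `T₁ = R (BP - B T₁)`, where `R` passes through the sum by continuity
in finite dimension; then `sylvesterInv_eq` removes `R`. -/
theorem T₁_eq {H E : Matrix (Fin L) (Fin K) ℝ} {δ : ℝ} (hH : H ≠ 0)
    (hB : 4 * ‖pert H E δ‖ < muMin H) (h : ∀ μ ∈ posEig H, IsUnit (resArg H E δ μ)) :
    T₁ H E δ = pinv H * (pert H E δ * eigProj H 0 - pert H E δ * T₁ H E δ
      + T₁ H E δ * (eigProj H 0 * pert H E δ * eigProj H 0)) := by
  have hs := summable_T₁term hH hB h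
  let F := LinearMap.toContinuousLinearMap
    (sylvesterInv H E δ ∘ₗ LinearMap.mulLeft ℝ (pert H E δ))
  have hF : ∀ Y, F Y = sylvesterInv H E δ (pert H E δ * Y) := fun _ => rfl
  have h1 : T₁ H E δ = sylvesterInv H E δ (pert H E δ * eigProj H 0 - pert H E δ * T₁ H E δ) := by
    rw [map_sub, ← L₁_eq, ← hF]
    conv_lhs => rw [T₁, hs.tsum_eq_zero_add, T₁term_zero]
    rw [T₁, F.map_tsum hs, sub_eq_add_neg, ← tsum_neg]
    simp only [hF, T₁term_succ]
  have h2 := sylvesterInv_eq h (pert H E δ * eigProj H 0 - pert H E δ * T₁ H E δ)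
  rwa [← h1] at h2

/-! ### Spectral bounds for the perturbed projector -/

theorem gramEig_le_add (H H' : Matrix (Fin L) (Fin K) ℝ) (j : Fin L) :
    gramEig H j ≤ gramEig H' j + ‖gram H' - gram H‖ := by
  refine LinearMap.IsSymmetric.eigenvalues_le_add finrank_euclideanSpace_fin
    (gram_isSymmetric H) (gram_isSymmetric H') _ (fun y => ?_) j
  have h1 := real_inner_le_norm (Matrix.toEuclideanLin (gram H - gram H') y) y
  have h2 := (Matrix.toEuclideanCLM (n := Fin L) (𝕜 := ℝ) (gram H - gram H')).le_opNorm y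
  rw [Matrix.l2_opNorm_toEuclideanCLM, norm_sub_rev] at h2
  have h3 := mul_le_mul_of_nonneg_right h2 (norm_nonneg y)
  have h4 := h1.trans h3
  rw [map_sub, LinearMap.sub_apply, inner_sub_left] at h4
  nlinarith

theorem signalProjPert_apply_gramBasis (H E : Matrix (Fin L) (Fin K) ℝ) (δ : ℝ) (j : Fin L) :
    Matrix.toEuclideanLin (signalProjPert H E δ) (gramBasis (H + δ • E) j)
      = if (j : ℕ) < H.rank then gramBasis (H + δ • E) j else 0 := by
  rw [signalProjPert, projMatrix_apply]
  split_ifs with h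
  · rw [Submodule.starProjection_eq_self_iff]
    exact Submodule.subset_span ⟨j, h, rfl⟩
  · rw [Submodule.starProjection_apply_eq_zero_iff, leadingSubspace, Submodule.mem_orthogonal]
    intro u hu
    induction hu using Submodule.span_induction with
    | mem u hu =>
      obtain ⟨k, hk, rfl⟩ := hu
      exact (gramBasis (H + δ • E)).inner_eq_zero (by rintro rfl; exact h hk)
    | zero => simp
    | add u v _ _ hu hv => rw [inner_add_left, hu, hv, add_zero]
    | smul a u _ hu => rw [real_inner_smul_left, hu, mul_zero]

theorem gram_commute_signalProjPert (H E : Matrix (Fin L) (Fin K) ℝ) (δ : ℝ) :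
    gram (H + δ • E) * signalProjPert H E δ = signalProjPert H E δ * gram (H + δ • E) := by
  refine Matrix.ext_orthonormalBasis (gramBasis (H + δ • E)) fun j => ?_
  simp only [Matrix.toEuclideanLin_mul_apply, gram_apply_gramBasis, map_smul,
    signalProjPert_apply_gramBasis]
  split_ifs <;> simp [gram_apply_gramBasis]

theorem norm_gram_mul_one_sub_signalProjPert_le (H E : Matrix (Fin L) (Fin K) ℝ) (δ : ℝ) :
    ‖gram (H + δ • E) * (1 - signalProjPert H E δ)‖ ≤ ‖pert H E δ‖ := by
  set b := gramBasis (H + δ • E)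
  have h := Matrix.l2_opNorm_mul_le_of_apply (C := ‖pert H E δ‖) (norm_nonneg _)
    (norm_apply_le_of_diagonal b
      (Matrix.toEuclideanLin (gram (H + δ • E) * (1 - signalProjPert H E δ)))
      (Matrix.toEuclideanLin (1 - signalProjPert H E δ))
      (fun j => if (j : ℕ) < H.rank then 0 else gramEig (H + δ • E) j)
      (fun j => if (j : ℕ) < H.rank then 0 else 1) _ (norm_nonneg _)
      (fun j => ?_) (fun j => ?_) fun j => ?_) 1
  · rw [mul_one, mul_one] at h
    refine h.trans (mul_le_of_le_one_right (norm_nonneg _) ?_)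
    rw [signalProjPert, one_sub_projMatrix]
    exact norm_projMatrix_le _
  · simp only [Matrix.toEuclideanLin_mul_apply, map_sub, LinearMap.sub_apply,
      Matrix.toEuclideanLin_one_apply, b, signalProjPert_apply_gramBasis]
    split_ifs <;> simp [gram_apply_gramBasis]
  · simp only [map_sub, LinearMap.sub_apply, Matrix.toEuclideanLin_one_apply, b,
      signalProjPert_apply_gramBasis]
    split_ifs <;> simp
  · split_ifs with hj
    · simp
    -- Weyl's inequality against an eigenvalue of `H Hᵀ` beyond the rank.
    · have h0 : gramEig H j = 0 :=
        le_antisymm (not_lt.1 (mt (gramEig_pos_iff H j).1 hj)) (gramEig_nonneg H j)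
      have h1 := gramEig_le_add (H + δ • E) H j
      rw [gram_add_smul, norm_sub_rev, add_sub_cancel_left, h0, zero_add] at h1
      rwa [abs_one, mul_one, abs_of_nonneg (gramEig_nonneg _ j)]

theorem norm_signalProjPert_mul_le {H E : Matrix (Fin L) (Fin K) ℝ} {δ : ℝ}
    (hB : ‖pert H E δ‖ < muMin H) (Y : Matrix (Fin L) (Fin L) ℝ) :
    (muMin H - ‖pert H E δ‖) * ‖signalProjPert H E δ * Y‖
      ≤ ‖gram (H + δ • E) * (signalProjPert H E δ * Y)‖ := by
  set b := gramBasis (H + δ • E)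
  have hpos : 0 < muMin H - ‖pert H E δ‖ := sub_pos.2 hB
  have h := Matrix.l2_opNorm_mul_le_of_apply (C := (muMin H - ‖pert H E δ‖)⁻¹) (by positivity)
    (norm_apply_le_of_diagonal b
      (Matrix.toEuclideanLin (signalProjPert H E δ))
      (Matrix.toEuclideanLin (gram (H + δ • E) * signalProjPert H E δ))
      (fun j => if (j : ℕ) < H.rank then 1 else 0)
      (fun j => if (j : ℕ) < H.rank then gramEig (H + δ • E) j else 0) _ (by positivity)
      (fun j => ?_) (fun j => ?_) fun j => ?_) Y
  · rwa [mul_assoc, ← div_eq_inv_mul, le_div_iff₀' hpos] at h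
  · simp only [b, signalProjPert_apply_gramBasis]
    split_ifs <;> simp
  · simp only [Matrix.toEuclideanLin_mul_apply, b, signalProjPert_apply_gramBasis]
    split_ifs <;> simp [gram_apply_gramBasis]
  · split_ifs with hj
    · have h0 := muMin_le_gramEig ((gramEig_pos_iff H j).2 hj)
      have h1 := gramEig_le_add H (H + δ • E) j
      rw [gram_add_smul, add_sub_cancel_left] at h1
      rw [abs_one, abs_of_nonneg (gramEig_nonneg _ j), inv_mul_eq_div, one_le_div hpos]
      linarith
    · simp

end SignalSubspace

theorem theorem6 {L K : ℕ} (H E : Matrix (Fin L) (Fin K) ℝ) (hH : H ≠ 0) (hE : E ≠ 0)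
    (hrank : H.rank < min L K) (δ₀ δ : ℝ) (hδ₀ : 0 < δ₀)
    (hB : pertBound H E δ₀ = muMin H / 4) (hδ : |δ| < δ₀) :
    (∀ μ ∈ posEig H, IsUnit (resArg H E δ μ)) ∧
    Summable (T₁term H E δ) ∧
    ‖signalProjPert H E δ - signalProj H - T H E δ‖ ≤
      16 * (Real.exp (1 / 6) / √Real.pi) *
        (‖pinv H * pert H E δ * eigProj H 0‖ ^ 2 / (1 - 4 * ‖pert H E δ‖ / muMin H)) := by
  have hm := muMin_pos hH
  have hlt : 4 * ‖pert H E δ‖ < muMin H := by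
    have h1 := norm_pert_le H E δ
    have h2 := pertBound_lt hE H hδ
    linarith
  have hlt' : ‖pert H E δ‖ < muMin H := by linarith [norm_nonneg (pert H E δ)]
  have hunit : ∀ μ ∈ posEig H, IsUnit (resArg H E δ μ) := fun μ hμ =>
    isUnit_resArg (hm.trans_le (muMin_le hμ)) (hlt'.trans_le (muMin_le hμ))
  refine ⟨hunit, summable_T₁term hH hlt hunit, ?_⟩
  have star_proj : ∀ U : Submodule ℝ (EuclideanSpace ℝ (Fin L)),
      star (projMatrix U) = projMatrix U := fun U => by
    rw [Matrix.star_eq_conjTranspose, Matrix.conjTranspose_eq_transpose_of_trivial,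
      projMatrix_transpose]
  have key := CStarRing.norm_projection_sub_le (A := gram H) (B := pert H E δ) (S := pinv H)
    (P := eigProj H 0) (Q := signalProjPert H E δ) (T := T₁ H E δ) hm hlt
    (projMatrix_mul_self _) (star_proj _) (projMatrix_mul_self _) (star_proj _)
    (norm_projMatrix_le _) (norm_signalProj_le H) (norm_projMatrix_le _)
    (by rw [signalProjPert, one_sub_projMatrix]; exact norm_projMatrix_le _)
    (by rw [gram_mul_eigProj, zero_smul]) (pinv_mul_gram H) (gram_mul_pinv H)
    (pinv_mul_eigProj_zero H)
    (by
      have h1 := norm_pinv_mul_le hH (signalProj H)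
      rw [pinv_mul_signalProj] at h1
      exact h1.trans ((div_le_div_of_nonneg_right (norm_signalProj_le H) hm.le).trans
        (one_div _).le))
    (by rw [← gram_add_smul, gram_commute_signalProjPert])
    (by rw [← gram_add_smul]; exact norm_gram_mul_one_sub_signalProjPert_le H E δ)
    (by rw [← gram_add_smul]; exact norm_signalProjPert_mul_le hlt' _)
    (T₁_eq hH hlt hunit)
  rw [Matrix.star_eq_conjTranspose, Matrix.conjTranspose_eq_transpose_of_trivial] at key
  refine key.trans (mul_le_mul_of_nonneg_right ?_ (div_nonneg (sq_nonneg _) ?_))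
  -- `8 ≤ 16 C` amounts to `C ≥ 1/2`.
  · have h1 : √Real.pi ≤ 2 := Real.sqrt_le_iff.2 ⟨by norm_num, by linarith [Real.pi_le_four]⟩
    have h2 : 0 < √Real.pi := Real.sqrt_pos.2 Real.pi_pos
    have h3 : 1 ≤ Real.exp (1 / 6) := Real.one_le_exp (by norm_num)
    have h4 : 1 / 2 ≤ Real.exp (1 / 6) / √Real.pi := by
      rw [le_div_iff₀ h2]
      linarith
    linarith
  · rw [sub_nonneg, div_le_one hm]
    exact hlt.le
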